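/- For an entire function $f:\mathbb{C}\to\mathbb{C}$ and $b>0$ put $\|f\|_b=\sup_{k\in\mathbb{N}_0} b^{-k}|f^{(k)}(0)|\in[0,\infty]$. For $a\ge 0$ let $\mathcal{A}_a$ be the vector space of all entire functions $f$ with $\|f\|_b<\infty$ for every $b>a$, equipped with the (Fréchet) topology defined by the family of norms $\{\|\cdot\|_b : b>a\}$. A set $B\subset\mathcal{A}_a$ is called bounded in $\mathcal{A}_a$ if for every $b>a$ there is a constant $C_b<\infty$ with $\sup_{f\in B}\|f\|_b\le C_b$. Let $\mathcal{L}^+$ be the set of all entire functions of the form $$f(z)=C z^{l}e^{\alpha z}\prod_{j=1}^{\infty}(1+\beta_j z),\qquad C\in\mathbb{C},\ l\in\mathbb{N}_0,\ \alpha\ge 0,\ \beta_j\ge\beta_{j+1}\ge 0,\ \sum_{j=1}^\infty\beta_j<\infty,$$ and let $\mathcal{L}^+_a=\mathcal{L}^+\cap\mathcal{A}_a$. Theorem. Let $a\ge 0$ and let $\{f_n\}_{n\in\mathbb{N}}\subset\mathcal{L}^+_a$ be a sequence that converges, uniformly on compact subsets of $\mathbb{C}$, to a function $f\in\mathcal{A}_a$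 that does not vanish identically. Then the set $\{f_n : n\in\mathbb{N}\}$ is bounded in $\mathcal{A}_a$, the sequence $\{f_n\}$ converges to $f$ in the topology of $\mathcal{A}_a$, and $f\in\mathcal{L}^+$. -/

import Mathlib

open Filter Topology
open scoped ENNReal

/-- The extended norm `‖f‖_b = sup_{k ≥ 0} b⁻ᵏ |f⁽ᵏ⁾(0)|` with values in `[0, ∞]`
(meant for entire `f` and `b > 0`). -/
noncomputable def taylorNorm (b : ℝ) (f : ℂ → ℂ) : ℝ≥0∞ :=
  ⨆ k : ℕ, ‖iteratedDeriv k f 0‖ₑ / ENNReal.ofReal b ^ k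

/-- The set `𝓑_b` of entire functions with `‖f‖_b < ∞` (meant for `b > 0`). -/
def taylorBanach (b : ℝ) : Set (ℂ → ℂ) :=
  {f | Differentiable ℂ f ∧ taylorNorm b f < ∞}

theorem taylorNorm_zero (b : ℝ) : taylorNorm b 0 = 0 := by
  have h : ∀ k : ℕ, iteratedDeriv k (0 : ℂ → ℂ) 0 = 0 := by
    intro k
    simp [Pi.zero_def]
  simp [taylorNorm, h]

theorem taylorNorm_add_le (b : ℝ) {f g : ℂ → ℂ} (hf : Differentiable ℂ f)
    (hg : Differentiable ℂ g) :
    taylorNorm b (f + g) ≤ taylorNorm b f + taylorNorm b g := by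
  refine iSup_le fun k => ?_
  rw [iteratedDeriv_add hf.contDiff.contDiffAt hg.contDiff.contDiffAt]
  calc ‖iteratedDeriv k f 0 + iteratedDeriv k g 0‖ₑ / ENNReal.ofReal b ^ k
      ≤ (‖iteratedDeriv k f 0‖ₑ + ‖iteratedDeriv k g 0‖ₑ) / ENNReal.ofReal b ^ k :=
        ENNReal.div_le_div_right (enorm_add_le _ _) _
    _ = ‖iteratedDeriv k f 0‖ₑ / ENNReal.ofReal b ^ k
        + ‖iteratedDeriv k g 0‖ₑ / ENNReal.ofReal b ^ k := ENNReal.add_div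
    _ ≤ taylorNorm b f + taylorNorm b g :=
        add_le_add (le_iSup (fun k => ‖iteratedDeriv k f 0‖ₑ / ENNReal.ofReal b ^ k) k)
          (le_iSup (fun k => ‖iteratedDeriv k g 0‖ₑ / ENNReal.ofReal b ^ k) k)

theorem taylorNorm_smul (b : ℝ) (c : ℂ) {f : ℂ → ℂ} (hf : Differentiable ℂ f) :
    taylorNorm b (c • f) = ‖c‖ₑ * taylorNorm b f := by
  unfold taylorNorm
  rw [ENNReal.mul_iSup]
  refine iSup_congr fun k => ?_
  rw [iteratedDeriv_const_smul hf.contDiff.contDiffAt, smul_eq_mul, enorm_mul, mul_div_assoc]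

/-- The linear space `𝓐_a = ⋂_{b > a} 𝓑_b` (meant for `a ≥ 0`). -/
noncomputable def expTypeSubmodule (a : ℝ) : Submodule ℂ (ℂ → ℂ) where
  carrier := ⋂ b > a, taylorBanach b
  zero_mem' := by
    simp only [Set.mem_iInter]
    exact fun b _ => ⟨differentiable_const 0, by simp [taylorNorm_zero]⟩
  add_mem' := by
    intro f g hf hg
    simp only [Set.mem_iInter] at hf hg ⊢
    exact fun b hb => ⟨(hf b hb).1.add (hg b hb).1,
      (taylorNorm_add_le b (hf b hb).1 (hg b hb).1).trans_lt
        (ENNReal.add_lt_top.2 ⟨(hf b hb).2, (hg b hb).2⟩)⟩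
  smul_mem' := by
    intro c f hf
    simp only [Set.mem_iInter] at hf ⊢
    refine fun b hb => ⟨(hf b hb).1.const_smul c, ?_⟩
    rw [taylorNorm_smul b c (hf b hb).1]
    exact ENNReal.mul_lt_top enorm_lt_top (hf b hb).2

theorem mem_expTypeSubmodule {a : ℝ} {f : ℂ → ℂ} :
    f ∈ expTypeSubmodule a ↔ ∀ b > a, f ∈ taylorBanach b := by
  change f ∈ ⋂ b > a, taylorBanach b ↔ _
  simp only [Set.mem_iInter]

/-- The space `𝓐_a` as a type of its own, so that it does not inherit the topology of pointwise
convergence from `ℂ → ℂ`. -/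
def ExpTypeSpace (a : ℝ) : Type := ↥(expTypeSubmodule a)

namespace ExpTypeSpace

noncomputable instance (a : ℝ) : AddCommGroup (ExpTypeSpace a) :=
  inferInstanceAs (AddCommGroup ↥(expTypeSubmodule a))

noncomputable instance (a : ℝ) : Module ℂ (ExpTypeSpace a) :=
  inferInstanceAs (Module ℂ ↥(expTypeSubmodule a))

/-- The entire function underlying an element of `𝓐_a`. -/
def toFun {a : ℝ} (f : ExpTypeSpace a) : ℂ → ℂ := f.1

instance (a : ℝ) : CoeFun (ExpTypeSpace a) (fun _ => ℂ → ℂ) := ⟨toFun⟩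

theorem mem_taylorBanach {a b : ℝ} (hb : a < b) (f : ExpTypeSpace a) :
    f.toFun ∈ taylorBanach b :=
  mem_expTypeSubmodule.1 f.2 b hb

/-- The norms `‖·‖_b`, `b > a`, restricted to `𝓐_a`, where they are finite. -/
noncomputable def seminorms (a : ℝ) : SeminormFamily ℂ (ExpTypeSpace a) {b : ℝ // a < b} :=
  fun b => Seminorm.of (fun f => (taylorNorm b f.toFun).toReal)
    (by
      intro f g
      have hf := mem_taylorBanach b.2 f
      have hg := mem_taylorBanach b.2 g
      rw [← ENNReal.toReal_add hf.2.ne hg.2.ne]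
      exact ENNReal.toReal_mono (ENNReal.add_lt_top.2 ⟨hf.2, hg.2⟩).ne
        (taylorNorm_add_le b hf.1 hg.1))
    (by
      intro c f
      have hf := mem_taylorBanach b.2 f
      have h : (c • f).toFun = c • f.toFun := rfl
      rw [h, taylorNorm_smul b c hf.1, ENNReal.toReal_mul, toReal_enorm])

instance (a : ℝ) : Nonempty {b : ℝ // a < b} := ⟨⟨a + 1, lt_add_one a⟩⟩

/-- The topology `𝓣_a`, defined by the family of norms `‖·‖_b`, `b > a`. -/
noncomputable instance (a : ℝ) : TopologicalSpace (ExpTypeSpace a) :=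
  (seminorms a).moduleFilterBasis.topology

/-- A set `B ⊆ 𝓐_a` is bounded if for each `b > a` the norms `‖f‖_b`, `f ∈ B`, have a common
finite bound. -/
def IsBoundedSet {a : ℝ} (B : Set (ExpTypeSpace a)) : Prop :=
  ∀ b > a, ∃ C : ℝ, ∀ f ∈ B, taylorNorm b f.toFun ≤ ENNReal.ofReal C

end ExpTypeSpace

/-- The class `𝓛⁺` of Laguerre entire functions
`f(z) = C zˡ exp(α z) ∏_j (1 + β_j z)` with `C ∈ ℂ`, `l ∈ ℕ`, `α ≥ 0`,
`β_1 ≥ β_2 ≥ ⋯ ≥ 0` and `∑ β_j < ∞` (the index `j` is shifted to start at `0`). -/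
def laguerrePlus : Set (ℂ → ℂ) :=
  {f | Differentiable ℂ f ∧
    ∃ (C : ℂ) (l : ℕ) (α : ℝ) (β : ℕ → ℝ),
      0 ≤ α ∧ Antitone β ∧ (∀ j, 0 ≤ β j) ∧ Summable β ∧
      ∀ z : ℂ, ∃ P : ℂ, HasProd (fun j => 1 + (β j : ℂ) * z) P ∧
        f z = C * z ^ l * Complex.exp (α * z) * P}

/-- The set `𝓛⁺_a = 𝓛⁺ ∩ 𝓐_a`, as a subset of `𝓐_a`. -/
def laguerrePlusIn (a : ℝ) : Set (ExpTypeSpace a) :=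
  {f | f.toFun ∈ laguerrePlus}

/-! Boundedness and convergence rest on Turán-type inequalities: for a Laguerre function the numbers
|f⁽ᵏ⁾(0)| have nonincreasing ratios (`isLogConcaveSeq_norm_iteratedDeriv`). The limit has some ratio
below any given b > a, hence so does f_n at that index for large n, and monotonicity carries this
ratio bound to all later indices. This bounds |f_n⁽ᵏ⁾(0)| by C bᵏ uniformly in n
(`exists_uniform_bound`); a slightly smaller b then upgrades convergence of each derivative to
convergence in norm.

For closure, expand at 1: f(1+w) = f(1) exp(αw) ∏(1+γ_j w) with 0 ≤ γ_j ≤ 1, zeros at the origin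
becoming factors with γ_j = 1. The values at 1 and 2 bound α + ∑γ_j, so the parameters have a limit
along an ultrafilter (`exists_limit_shiftedData`); mass of ∑γ_j lost in the limit reappears in the
exponential. The identity theorem identifies the limit product with g. -/

/-! ### Log-concave sequences -/

/-- Nonnegative sequences for which `p (k + 1) / p k` is nonincreasing, in a division-free form
that also excludes internal zeros. -/
structure IsLogConcaveSeq (p : ℕ → ℝ) : Prop where
  nonneg : ∀ k, 0 ≤ p k
  mul_le : ∀ i j, i ≤ j → p i * p (j + 1) ≤ p (i + 1) * p j

namespace IsLogConcaveSeq

theorem pow {α : ℝ} (hα : 0 ≤ α) : IsLogConcaveSeq (fun k => α ^ k) where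
  nonneg k := by positivity
  mul_le i j _ := by ring_nf; rfl

theorem const_mul {p : ℕ → ℝ} (hp : IsLogConcaveSeq p) {c : ℝ} (hc : 0 ≤ c) :
    IsLogConcaveSeq (fun k => c * p k) where
  nonneg k := mul_nonneg hc (hp.nonneg k)
  mul_le i j hij := by
    have := mul_le_mul_of_nonneg_left (hp.mul_le i j hij) (mul_nonneg hc hc)
    linarith

theorem of_tendsto {ι : Type*} {l : Filter ι} [l.NeBot] {p : ι → ℕ → ℝ} {q : ℕ → ℝ}
    (hp : ∀ n, IsLogConcaveSeq (p n)) (h : ∀ k, Tendsto (fun n => p n k) l (𝓝 (q k))) :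
    IsLogConcaveSeq q where
  nonneg k := ge_of_tendsto' (h k) fun n => (hp n).nonneg k
  mul_le i j hij := le_of_tendsto_of_tendsto' ((h i).mul (h (j + 1))) ((h (i + 1)).mul (h j))
    fun n => (hp n).mul_le i j hij

/-- The sequence of derivatives at `0` of `z * h z`. -/
theorem shift {p : ℕ → ℝ} (hp : IsLogConcaveSeq p) :
    IsLogConcaveSeq (fun k => k * p (k - 1)) where
  nonneg k := mul_nonneg k.cast_nonneg (hp.nonneg _)
  mul_le i j hij := by
    rcases i with _ | i
    · simpa using mul_nonneg (hp.nonneg 0) (mul_nonneg j.cast_nonneg (hp.nonneg (j - 1)))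
    obtain ⟨j, rfl⟩ : ∃ m, j = m + 1 := ⟨j - 1, by omega⟩
    have h := hp.mul_le i j (by omega)
    have hij' : (i : ℝ) ≤ j := by exact_mod_cast (by omega : i ≤ j)
    have h0 := mul_nonneg (hp.nonneg (i + 1)) (hp.nonneg j)
    simp only [Nat.add_sub_cancel]
    push_cast
    calc ((i : ℝ) + 1) * p i * ((j + 1 + 1) * p (j + 1))
        = ((i + 1) * (j + 2)) * (p i * p (j + 1)) := by ring
      _ ≤ ((i + 1) * (j + 2)) * (p (i + 1) * p j) := by gcongr
      -- The difference of the two coefficients is j - i.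
      _ ≤ ((i + 2) * (j + 1)) * (p (i + 1) * p j) := by
          apply mul_le_mul_of_nonneg_right _ h0
          nlinarith
      _ = _ := by ring

/-- The sequence of derivatives at `0` of `(1 + β * z) * h z`. -/
theorem add_shift {p : ℕ → ℝ} (hp : IsLogConcaveSeq p) {β : ℝ} (hβ : 0 ≤ β) :
    IsLogConcaveSeq (fun k => p k + β * (k * p (k - 1))) where
  nonneg k := add_nonneg (hp.nonneg k) (mul_nonneg hβ (hp.shift.nonneg k))
  mul_le i j hij := by
    -- The inequality is checked separately on the coefficients of 1, β and β²: these are `h1`, `h2`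
    -- and `h3`.
    have h1 := hp.mul_le i j hij
    have h3 := mul_le_mul_of_nonneg_left (hp.shift.mul_le i j hij) (mul_nonneg hβ hβ)
    have h2 : p i * ((j + 1) * p j) + i * p (i - 1) * p (j + 1)
        ≤ p (i + 1) * (j * p (j - 1)) + (i + 1) * p i * p j := by
      rcases hij.eq_or_lt with rfl | hlt
      · have : p (i + 1) * (i * p (i - 1)) = i * p (i - 1) * p (i + 1) := by ring
        linarith
      · obtain ⟨j, rfl⟩ : ∃ m, j = m + 1 := ⟨j - 1, by omega⟩
        have hij' : (i : ℝ) ≤ j := by exact_mod_cast (by omega : i ≤ j)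
        have ha := hp.mul_le i j (by omega)
        have hb : i * (p (i - 1) * p (j + 2)) ≤ i * (p i * p (j + 1)) := by
          rcases i with _ | i
          · simp
          · have := hp.mul_le i (j + 1) (by omega)
            simp only [Nat.add_sub_cancel]
            gcongr
        have hc := mul_le_mul_of_nonneg_left ha (by linarith : (0 : ℝ) ≤ j + 1)
        simp only [Nat.add_sub_cancel]
        push_cast
        have e : j + 1 + 1 = j + 2 := rfl
        rw [e]
        linarith
    have h2' := mul_le_mul_of_nonneg_left h2 hβ
    simp only [Nat.add_sub_cancel] at h3 ⊢
    push_cast at h3 ⊢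
    linarith

theorem le_mul_of_le {p : ℕ → ℝ} (hp : IsLogConcaveSeq p) {b : ℝ} {K : ℕ} (hK : 0 < p K)
    (h : p (K + 1) ≤ b * p K) {j : ℕ} (hj : K ≤ j) : p (j + 1) ≤ b * p j := by
  have h1 := hp.mul_le K j hj
  have h2 := mul_le_mul_of_nonneg_right h (hp.nonneg j)
  exact le_of_mul_le_mul_left (by linarith) hK

theorem add_le_of_le {p : ℕ → ℝ} (hp : IsLogConcaveSeq p) {b : ℝ} (hb : 0 ≤ b) {K : ℕ}
    (hK : 0 < p K) (h : p (K + 1) ≤ b * p K) (m : ℕ) : p (K + m) ≤ p K * b ^ m := by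
  induction m with
  | zero => simp
  | succ m ih =>
    calc p (K + m + 1) ≤ b * p (K + m) := hp.le_mul_of_le hK h (by omega)
      _ ≤ b * (p K * b ^ m) := by gcongr
      _ = _ := by ring

end IsLogConcaveSeq

/-! ### Uniform geometric bounds -/

/-- A nonzero sequence of growth at most `b₀ ^ k` has a ratio below `b` for any `b > b₀`. -/
theorem exists_ratio_lt {q : ℕ → ℝ} (hq : ∀ k, 0 ≤ q k) {k₀ : ℕ} (hk₀ : q k₀ ≠ 0) {b₀ b C : ℝ}
    (hb₀ : 0 < b₀) (hb : b₀ < b) (hC : ∀ k, q k ≤ C * b₀ ^ k) :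
    ∃ K, 0 < q K ∧ q (K + 1) < b * q K := by
  by_contra! hcon
  have hpos : 0 < q k₀ := lt_of_le_of_ne (hq _) hk₀.symm
  have hb0 : 0 < b := hb₀.trans hb
  -- If every ratio is at least b, the sequence grows like bᵐ from `k₀` on, which beats `b₀`.
  have key : ∀ m, q k₀ * b ^ m ≤ q (k₀ + m) := by
    intro m
    induction m with
    | zero => simp
    | succ m ih =>
      have hm : 0 < q (k₀ + m) := lt_of_lt_of_le (by positivity) ih
      calc q k₀ * b ^ (m + 1) = b * (q k₀ * b ^ m) := by ring
        _ ≤ b * q (k₀ + m) := by gcongr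
        _ ≤ _ := hcon _ hm
  have hlim : Tendsto (fun m : ℕ => C * b₀ ^ k₀ * (b₀ / b) ^ m) atTop (𝓝 (C * b₀ ^ k₀ * 0)) :=
    (tendsto_pow_atTop_nhds_zero_of_lt_one (by positivity) ((div_lt_one hb0).2 hb)).const_mul _
  have hle : ∀ m : ℕ, q k₀ ≤ C * b₀ ^ k₀ * (b₀ / b) ^ m := by
    intro m
    have h1 := (key m).trans (hC _)
    rw [div_pow, mul_div_assoc', le_div_iff₀ (by positivity)]
    calc _ ≤ _ := h1
      _ = _ := by ring
  have := ge_of_tendsto' hlim hle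
  linarith

/-- Pointwise convergence of log-concave sequences to a nonzero sequence of growth less than
`b ^ k` forces a uniform bound by a multiple of `b ^ k`. -/
theorem exists_uniform_bound {p : ℕ → ℕ → ℝ} {q : ℕ → ℝ} (hp : ∀ n, IsLogConcaveSeq (p n))
    (hlim : ∀ k, Tendsto (fun n => p n k) atTop (𝓝 (q k))) {k₀ : ℕ} (hk₀ : q k₀ ≠ 0)
    {b₀ b C₀ : ℝ} (hb₀ : 0 < b₀) (hb : b₀ < b) (hC₀ : ∀ k, q k ≤ C₀ * b₀ ^ k)
    (hfin : ∀ n, ∃ C, ∀ k, p n k ≤ C * b ^ k) :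
    ∃ C, ∀ n k, p n k ≤ C * b ^ k := by
  have hq := IsLogConcaveSeq.of_tendsto hp hlim
  have hb0 : 0 < b := hb₀.trans hb
  obtain ⟨K, hK, hK'⟩ := exists_ratio_lt hq.nonneg hk₀ hb₀ hb hC₀
  have hev : ∀ᶠ n in atTop, 0 < p n K ∧ p n (K + 1) < b * p n K :=
    ((hlim K).eventually_const_lt hK).and
      ((hlim (K + 1)).eventually_lt ((hlim K).const_mul b) hK')
  obtain ⟨N, hN⟩ := eventually_atTop.1 hev
  choose D hD using fun k => (hlim k).bddAbove_range
  choose E hE using hfin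
  have hD' : ∀ n k, p n k ≤ D k := fun n k => hD k ⟨n, rfl⟩
  have hD0 : ∀ k, 0 ≤ D k := fun k => ((hp 0).nonneg k).trans (hD' 0 k)
  have hE0 : ∀ n, 0 ≤ E n := fun n => by simpa using ((hp n).nonneg 0).trans (hE n 0)
  have hnn : ∀ j ∈ Finset.range (K + 1), 0 ≤ D j / b ^ j := fun j _ =>
    div_nonneg (hD0 j) (by positivity)
  have h1 : 0 ≤ ∑ j ∈ Finset.range (K + 1), D j / b ^ j := Finset.sum_nonneg hnn
  have h2 : 0 ≤ ∑ n ∈ Finset.range N, E n := Finset.sum_nonneg fun n _ => hE0 n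
  -- The first sum serves all n ≥ N, where the indices past K follow from the ratio at K; the second
  -- serves the finitely many n < N.
  refine ⟨∑ j ∈ Finset.range (K + 1), D j / b ^ j + ∑ n ∈ Finset.range N, E n, fun n k => ?_⟩
  have hDj : ∀ j ≤ K, D j / b ^ j ≤ ∑ j ∈ Finset.range (K + 1), D j / b ^ j := fun j hj =>
    Finset.single_le_sum hnn (Finset.mem_range.2 (by omega))
  rcases lt_or_ge n N with hn | hn
  · refine (hE n k).trans ?_
    gcongr
    have := Finset.single_le_sum (fun n _ => hE0 n) (Finset.mem_range.2 hn)
    linarith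
  · have hmain : p n k ≤ (∑ j ∈ Finset.range (K + 1), D j / b ^ j) * b ^ k := by
      rcases le_total k K with hk | hk
      · calc p n k ≤ D k := hD' n k
          _ = D k / b ^ k * b ^ k := by field_simp
          _ ≤ _ := by gcongr; exact hDj k hk
      · obtain ⟨m, rfl⟩ := Nat.exists_eq_add_of_le hk
        calc p n (K + m) ≤ p n K * b ^ m := (hp n).add_le_of_le hb0.le (hN n hn).1 (hN n hn).2.le m
          _ ≤ D K * b ^ m := by gcongr; exact hD' n K
          _ = D K / b ^ K * b ^ (K + m) := by rw [pow_add]; field_simp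
          _ ≤ _ := by gcongr; exact hDj K le_rfl
    refine hmain.trans ?_
    gcongr
    linarith

/-- Tannery-type criterion for convergence in a weighted sup norm. -/
theorem eventually_le_mul_pow {d : ℕ → ℕ → ℝ} {b₀ b D : ℝ} (hb₀ : 0 < b₀) (hb : b₀ < b)
    (hD : ∀ n k, d n k ≤ D * b₀ ^ k) (hlim : ∀ k, Tendsto (fun n => d n k) atTop (𝓝 0))
    {ε : ℝ} (hε : 0 < ε) : ∀ᶠ n in atTop, ∀ k, d n k ≤ ε * b ^ k := by
  have hb0 : 0 < b := hb₀.trans hb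
  have hr : Tendsto (fun m : ℕ => |D| * (b₀ / b) ^ m) atTop (𝓝 (|D| * 0)) :=
    (tendsto_pow_atTop_nhds_zero_of_lt_one (by positivity) ((div_lt_one hb0).2 hb)).const_mul _
  rw [mul_zero] at hr
  obtain ⟨K, hK⟩ := eventually_atTop.1 (hr.eventually_lt_const hε)
  have hfin : ∀ᶠ n in atTop, ∀ k ∈ Finset.range K, d n k < ε * b ^ k :=
    (Finset.eventually_all _).2 fun k _ => (hlim k).eventually_lt_const (by positivity)
  filter_upwards [hfin] with n hn k
  rcases lt_or_ge k K with hk | hk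
  · exact (hn k (Finset.mem_range.2 hk)).le
  · calc d n k ≤ D * b₀ ^ k := hD n k
      _ ≤ |D| * b₀ ^ k := by gcongr; exact le_abs_self D
      _ = |D| * (b₀ / b) ^ k * b ^ k := by rw [div_pow]; field_simp
      _ ≤ _ := by gcongr; exact (hK k hk).le

/-! ### Log-concavity of the derivatives at 0 -/

theorem iteratedDeriv_id_mul_zero {h : ℂ → ℂ} (hh : Differentiable ℂ h) (k : ℕ) :
    iteratedDeriv k (fun z => z * h z) 0 = k * iteratedDeriv (k - 1) h 0 := by
  induction k generalizing h with
  | zero => simp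
  | succ k ih =>
    have hd : Differentiable ℂ (deriv h) := (hh.contDiff (n := 2)).differentiable_deriv_two
    have e : deriv (fun z => z * h z) = h + fun z => z * deriv h z := by
      funext z
      have := ((hasDerivAt_id' z).fun_mul (hh z).hasDerivAt).deriv
      simpa using this
    have hm : Differentiable ℂ fun z => z * deriv h z := differentiable_id.mul hd
    rw [iteratedDeriv_succ', e, iteratedDeriv_add hh.contDiff.contDiffAt
      hm.contDiff.contDiffAt, ih hd, Nat.add_sub_cancel]
    rcases k with _ | k
    · simp
    · simp only [Nat.add_sub_cancel, ← iteratedDeriv_succ']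
      push_cast
      ring

theorem TendstoLocallyUniformlyOn.tendsto_iteratedDeriv {ι : Type*} {l : Filter ι} [l.NeBot]
    {F : ι → ℂ → ℂ} {f : ℂ → ℂ} (h : TendstoLocallyUniformlyOn F f l Set.univ)
    (hF : ∀ n, Differentiable ℂ (F n)) (k : ℕ) (z : ℂ) :
    Tendsto (fun n => iteratedDeriv k (F n) z) l (𝓝 (iteratedDeriv k f z)) := by
  induction k generalizing F f with
  | zero => simpa using h.tendsto_at (Set.mem_univ z)
  | succ k ih =>
    simp only [iteratedDeriv_succ']
    exact ih (h.deriv (Eventually.of_forall fun n => (hF n).differentiableOn) isOpen_univ)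
      fun n => ((hF n).contDiff (n := 2)).differentiable_deriv_two

/-- Entire functions whose derivatives at `0` form a log-concave sequence of nonnegative reals. -/
def HasLogConcaveTaylor (h : ℂ → ℂ) : Prop :=
  Differentiable ℂ h ∧ ∃ p, IsLogConcaveSeq p ∧ ∀ k, iteratedDeriv k h 0 = (p k : ℂ)

namespace HasLogConcaveTaylor

theorem exp {α : ℝ} (hα : 0 ≤ α) : HasLogConcaveTaylor (fun z => Complex.exp (α * z)) := by
  refine ⟨by fun_prop, fun k => α ^ k, .pow hα, fun k => ?_⟩
  rw [iteratedDeriv_cexp_const_mul]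
  simp

theorem id_mul {h : ℂ → ℂ} (hh : HasLogConcaveTaylor h) :
    HasLogConcaveTaylor (fun z => z * h z) := by
  obtain ⟨hd, p, hp, e⟩ := hh
  refine ⟨differentiable_id.mul hd, _, hp.shift, fun k => ?_⟩
  rw [iteratedDeriv_id_mul_zero hd, e]
  simp

theorem one_add_mul {h : ℂ → ℂ} (hh : HasLogConcaveTaylor h) {β : ℝ} (hβ : 0 ≤ β) :
    HasLogConcaveTaylor (fun z => (1 + β * z) * h z) := by
  obtain ⟨hd, p, hp, e⟩ := hh
  have hz : Differentiable ℂ (fun z => z * h z) := differentiable_id.mul hd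
  have e' : (fun z => (1 + β * z) * h z) = h + (β : ℂ) • fun z => z * h z := by
    funext z
    simp only [Pi.add_apply, Pi.smul_apply, smul_eq_mul]
    ring
  rw [e']
  refine ⟨hd.add (hz.const_smul _), _, hp.add_shift hβ, fun k => ?_⟩
  rw [iteratedDeriv_add hd.contDiff.contDiffAt (hz.const_smul _).contDiff.contDiffAt,
    iteratedDeriv_const_smul hz.contDiff.contDiffAt, iteratedDeriv_id_mul_zero hd, e, e]
  simp

theorem pow_mul {h : ℂ → ℂ} (hh : HasLogConcaveTaylor h) (l : ℕ) :
    HasLogConcaveTaylor (fun z => z ^ l * h z) := by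
  induction l with
  | zero => simpa using hh
  | succ l ih => simpa only [pow_succ', mul_assoc] using ih.id_mul

theorem mul_prod {h : ℂ → ℂ} (hh : HasLogConcaveTaylor h) {β : ℕ → ℝ} (hβ : ∀ j, 0 ≤ β j)
    (N : ℕ) : HasLogConcaveTaylor (fun z => h z * ∏ j ∈ Finset.range N, (1 + β j * z)) := by
  induction N with
  | zero => simpa using hh
  | succ N ih =>
    convert ih.one_add_mul (hβ N) using 2 with z
    rw [Finset.prod_range_succ]
    ring

theorem of_tendsto {F : ℕ → ℂ → ℂ} {f : ℂ → ℂ} (hF : ∀ n, HasLogConcaveTaylor (F n))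
    (h : TendstoLocallyUniformlyOn F f atTop Set.univ) : HasLogConcaveTaylor f := by
  have hd : Differentiable ℂ f := differentiableOn_univ.1
    (h.differentiableOn (Eventually.of_forall fun n => (hF n).1.differentiableOn) isOpen_univ)
  choose p hp e using fun n => (hF n).2
  have hlim := fun k => h.tendsto_iteratedDeriv (fun n => (hF n).1) k 0
  simp only [e] at hlim
  have hre : ∀ k, Tendsto (fun n => p n k) atTop (𝓝 (iteratedDeriv k f 0).re) := fun k => by
    simpa [Function.comp_def] using (Complex.continuous_re.tendsto _).comp (hlim k)
  refine ⟨hd, _, IsLogConcaveSeq.of_tendsto hp hre, fun k => ?_⟩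
  exact tendsto_nhds_unique (hlim k) ((Complex.continuous_ofReal.tendsto _).comp (hre k))

end HasLogConcaveTaylor

theorem hasProdLocallyUniformlyOn_one_add_mul {β : ℕ → ℝ} (hβ : Summable β) :
    HasProdLocallyUniformlyOn (fun j (z : ℂ) => 1 + (β j : ℂ) * z)
      (fun z => ∏' j, (1 + (β j : ℂ) * z)) Set.univ := by
  refine hasProdLocallyUniformlyOn_of_forall_compact isOpen_univ fun K _ hK => ?_
  obtain ⟨R, hR⟩ := hK.isBounded.exists_norm_le
  refine Summable.hasProdUniformlyOn_one_add hK (hβ.abs.mul_right R)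
    (Eventually.of_forall fun j z hz => ?_) fun j => by fun_prop
  rw [norm_mul, Complex.norm_real, Real.norm_eq_abs]
  exact mul_le_mul_of_nonneg_left (hR z hz) (abs_nonneg _)

theorem hasProd_one_add_mul {β : ℕ → ℝ} (hβ : Summable β) (z : ℂ) :
    HasProd (fun j => 1 + (β j : ℂ) * z) (∏' j, (1 + (β j : ℂ) * z)) :=
  (hasProdLocallyUniformlyOn_one_add_mul hβ).hasProd (Set.mem_univ z)

theorem differentiable_tprod_one_add_mul {β : ℕ → ℝ} (hβ : Summable β) :
    Differentiable ℂ (fun z : ℂ => ∏' j, (1 + (β j : ℂ) * z)) :=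
  differentiableOn_univ.1 <|
    (hasProdLocallyUniformlyOn_one_add_mul hβ).tendstoLocallyUniformlyOn_finsetRange.differentiableOn
      (Eventually.of_forall fun N => (by fun_prop : Differentiable ℂ fun z : ℂ =>
        ∏ j ∈ Finset.range N, (1 + (β j : ℂ) * z)).differentiableOn) isOpen_univ

theorem mem_laguerrePlus_iff {f : ℂ → ℂ} : f ∈ laguerrePlus ↔
    ∃ (C : ℂ) (l : ℕ) (α : ℝ) (β : ℕ → ℝ), 0 ≤ α ∧ Antitone β ∧ (∀ j, 0 ≤ β j) ∧ Summable β ∧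
      ∀ z, f z = C * z ^ l * Complex.exp (α * z) * ∏' j, (1 + (β j : ℂ) * z) := by
  constructor
  · rintro ⟨-, C, l, α, β, hα, hanti, hnn, hsum, h⟩
    refine ⟨C, l, α, β, hα, hanti, hnn, hsum, fun z => ?_⟩
    obtain ⟨P, hP, e⟩ := h z
    rw [e, hP.tprod_eq]
  · rintro ⟨C, l, α, β, hα, hanti, hnn, hsum, h⟩
    refine ⟨?_, C, l, α, β, hα, hanti, hnn, hsum, fun z => ⟨_, hasProd_one_add_mul hsum z, h z⟩⟩
    rw [funext h]
    exact Differentiable.mul (by fun_prop) (differentiable_tprod_one_add_mul hsum)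

/-- Start from the exponential, multiply by z and by 1 + β_j z, and pass to the locally uniform
limit of the partial products. Norms absorb the complex constant C. -/
theorem isLogConcaveSeq_norm_iteratedDeriv {f : ℂ → ℂ} (hf : f ∈ laguerrePlus) :
    IsLogConcaveSeq (fun k => ‖iteratedDeriv k f 0‖) := by
  obtain ⟨C, l, α, β, hα, -, hnn, hsum, h⟩ := mem_laguerrePlus_iff.1 hf
  have hc : Continuous fun z : ℂ => z ^ l * Complex.exp (α * z) := by fun_prop
  have hP := (hasProdLocallyUniformlyOn_one_add_mul hsum).tendstoLocallyUniformlyOn_finsetRange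
  have hconst : TendstoLocallyUniformlyOn
      (fun (_ : ℕ) (z : ℂ) => z ^ l * Complex.exp (α * z))
      (fun z => z ^ l * Complex.exp (α * z)) atTop Set.univ := by
    intro u hu x _
    exact ⟨Set.univ, univ_mem, Eventually.of_forall fun _ _ _ => refl_mem_uniformity hu⟩
  have hlim := hconst.mul₀ hP hc.continuousOn
    (differentiable_tprod_one_add_mul hsum).continuous.continuousOn
  obtain ⟨hd, p, hp, e⟩ := HasLogConcaveTaylor.of_tendsto
    (fun N => ((HasLogConcaveTaylor.exp hα).pow_mul l).mul_prod hnn N) hlim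
  have e' : f = C • ((fun z => z ^ l * Complex.exp (α * z)) *
      fun z : ℂ => ∏' j, (1 + (β j : ℂ) * z)) := by
    funext z
    simp only [h, Pi.smul_apply, Pi.mul_apply, smul_eq_mul, mul_assoc]
  convert hp.const_mul (norm_nonneg C) using 2 with k
  rw [e', iteratedDeriv_const_smul hd.contDiff.contDiffAt, norm_smul]
  congr 1
  exact (congrArg norm (e k)).trans (by simp [abs_of_nonneg (hp.nonneg k)])

/-! ### Boundedness and convergence in the weighted norms -/

theorem taylorNorm_le_iff {b C : ℝ} (hb : 0 < b) (hC : 0 ≤ C) {f : ℂ → ℂ} :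
    taylorNorm b f ≤ ENNReal.ofReal C ↔ ∀ k, ‖iteratedDeriv k f 0‖ ≤ C * b ^ k := by
  have hb' : ENNReal.ofReal b ≠ 0 := by simpa using hb
  simp only [taylorNorm, iSup_le_iff]
  refine forall_congr' fun k => ?_
  rw [ENNReal.div_le_iff (pow_ne_zero _ hb') (ENNReal.pow_ne_top ENNReal.ofReal_ne_top),
    ← ENNReal.ofReal_pow hb.le, ← ENNReal.ofReal_mul hC, ← ofReal_norm,
    ENNReal.ofReal_le_ofReal_iff (by positivity)]

theorem norm_iteratedDeriv_le_of_mem_taylorBanach {b : ℝ} (hb : 0 < b) {f : ℂ → ℂ}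
    (hf : f ∈ taylorBanach b) (k : ℕ) :
    ‖iteratedDeriv k f 0‖ ≤ (taylorNorm b f).toReal * b ^ k :=
  (taylorNorm_le_iff hb ENNReal.toReal_nonneg).1 (ENNReal.ofReal_toReal hf.2.ne).ge k

theorem exists_iteratedDeriv_ne_zero {f : ℂ → ℂ} (hf : Differentiable ℂ f) {z : ℂ}
    (hz : f z ≠ 0) : ∃ k, iteratedDeriv k f 0 ≠ 0 := by
  by_contra! hcon
  apply hz
  rw [← Complex.taylorSeries_eq_of_entire' 0 z hf]
  simp [hcon]

theorem bounded_and_tendsto_of_tendsto_iteratedDeriv {a : ℝ} (ha : 0 ≤ a)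
    {f : ℕ → ExpTypeSpace a} {g : ExpTypeSpace a} (hf : ∀ n, f n ∈ laguerrePlusIn a)
    (hg : ∃ z : ℂ, g z ≠ 0)
    (hlim : ∀ k, Tendsto (fun n => iteratedDeriv k (f n).toFun 0) atTop
      (𝓝 (iteratedDeriv k g.toFun 0))) :
    ExpTypeSpace.IsBoundedSet (Set.range f) ∧ Tendsto f atTop (𝓝 g) := by
  have hdiff : ∀ h : ExpTypeSpace a, Differentiable ℂ h.toFun := fun h =>
    (ExpTypeSpace.mem_taylorBanach (lt_add_one a) h).1
  obtain ⟨z, hz⟩ := hg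
  obtain ⟨k₀, hk₀⟩ := exists_iteratedDeriv_ne_zero (hdiff g) hz
  have bound : ∀ b > a, ∃ C, ∀ n k, ‖iteratedDeriv k (f n).toFun 0‖ ≤ C * b ^ k := by
    intro b hb
    obtain ⟨b₀, hb₀, hb₀'⟩ := exists_between hb
    exact exists_uniform_bound (fun n => isLogConcaveSeq_norm_iteratedDeriv (hf n))
      (fun k => (hlim k).norm) (norm_ne_zero_iff.2 hk₀) (ha.trans_lt hb₀) hb₀'
      (norm_iteratedDeriv_le_of_mem_taylorBanach (ha.trans_lt hb₀)
        (ExpTypeSpace.mem_taylorBanach hb₀ g))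
      fun n => ⟨_, norm_iteratedDeriv_le_of_mem_taylorBanach (ha.trans_lt hb)
        (ExpTypeSpace.mem_taylorBanach hb (f n))⟩
  constructor
  · intro b hb
    obtain ⟨C, hC⟩ := bound b hb
    have hC0 : 0 ≤ C := by simpa using (norm_nonneg _).trans (hC 0 0)
    refine ⟨C, ?_⟩
    rintro _ ⟨n, rfl⟩
    exact (taylorNorm_le_iff (ha.trans_lt hb) hC0).2 (hC n)
  · rw [(WithSeminorms.mk rfl : WithSeminorms (ExpTypeSpace.seminorms a)).tendsto_nhds]
    rintro ⟨b, hb⟩ ε hε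
    -- Bounds at the smaller weight make the tail small at weight b, uniformly in n.
    obtain ⟨b₀, hb₀, hb₀'⟩ := exists_between hb
    obtain ⟨C, hC⟩ := bound b₀ hb₀
    have hg₀ := norm_iteratedDeriv_le_of_mem_taylorBanach (ha.trans_lt hb₀)
        (ExpTypeSpace.mem_taylorBanach hb₀ g)
    have hd : ∀ k, Tendsto (fun n => ‖iteratedDeriv k (f n).toFun 0 - iteratedDeriv k g.toFun 0‖)
        atTop (𝓝 0) := fun k => by
      simpa using ((hlim k).sub_const (iteratedDeriv k g.toFun 0)).norm
    filter_upwards [eventually_le_mul_pow (ha.trans_lt hb₀) hb₀' (fun n k =>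
      (norm_sub_le _ _).trans ((add_le_add (hC n k) (hg₀ k)).trans_eq (add_mul _ _ _).symm)) hd
      (half_pos hε)] with n hn
    have hle : taylorNorm b (f n - g).toFun ≤ ENNReal.ofReal (ε / 2) := by
      refine (taylorNorm_le_iff (ha.trans_lt hb) (half_pos hε).le).2 fun k => ?_
      have e : (f n - g).toFun = (f n).toFun - g.toFun := rfl
      rw [e, iteratedDeriv_sub (hdiff _).contDiff.contDiffAt (hdiff _).contDiff.contDiffAt]
      exact hn k
    calc (taylorNorm b (f n - g).toFun).toReal ≤ ε / 2 :=
          ENNReal.toReal_le_of_le_ofReal (half_pos hε).le hle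
      _ < ε := half_lt_self hε

/-! ### Compactness of products recentred at 1 -/

theorem log_one_add_mul_sub_bounds {γ x : ℝ} (hγ : 0 ≤ γ) (hx : 0 ≤ x) :
    |Real.log (1 + γ * x) - γ * x| ≤ (γ * x) ^ 2 := by
  have hy : 0 ≤ γ * x := mul_nonneg hγ hx
  generalize γ * x = y at hy
  have h1 := Real.log_le_sub_one_of_pos (by linarith : 0 < 1 + y)
  have h2 := Real.le_log_one_add_of_nonneg hy
  have h3 : y - 2 * y / (y + 2) ≤ y ^ 2 := by
    have : y - 2 * y / (y + 2) = y ^ 2 / (y + 2) := by field_simp; ring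
    rw [this]
    exact div_le_self (sq_nonneg y) (by linarith)
  rw [abs_le]
  constructor <;> nlinarith [sq_nonneg y]

theorem Antitone.le_div_of_tsum_le {γ : ℕ → ℝ} (hanti : Antitone γ) (hnn : ∀ j, 0 ≤ γ j)
    (hsum : Summable γ) {M : ℝ} (hM : ∑' j, γ j ≤ M) (j : ℕ) : γ j ≤ M / (j + 1) := by
  rw [le_div_iff₀ (by positivity)]
  calc γ j * (j + 1) = ∑ i ∈ Finset.range (j + 1), γ j := by simp [mul_comm]
    _ ≤ ∑ i ∈ Finset.range (j + 1), γ i :=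
        Finset.sum_le_sum fun i hi => hanti (Finset.mem_range_succ_iff.1 hi)
    _ ≤ ∑' j, γ j := hsum.sum_le_tsum _ fun i _ => hnn i
    _ ≤ M := hM

theorem summable_log_one_add_mul {γ : ℕ → ℝ} (hsum : Summable γ) (x : ℝ) :
    Summable fun j => Real.log (1 + γ j * x) :=
  Real.summable_log_one_add_of_summable (hsum.mul_right x)

/-- The parameters of a product `exp (α w) * ∏ (1 + γ j * w)` with zeros in `(-∞, -1]`. -/
structure IsShiftedData (α : ℝ) (γ : ℕ → ℝ) : Prop where
  nonneg_exp : 0 ≤ α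
  anti : Antitone γ
  nonneg : ∀ j, 0 ≤ γ j
  le_one : ∀ j, γ j ≤ 1
  summable : Summable γ

/-- Uses log(1+y) ≥ 2y/(y+2) ≥ 2y/3 on [0,1]. It turns a bound on the product at w = 1 into a bound
on the parameters. -/
theorem IsShiftedData.tsum_le_log {α : ℝ} {γ : ℕ → ℝ} (h : IsShiftedData α γ) :
    α + ∑' j, γ j ≤ 3 / 2 * (α + ∑' j, Real.log (1 + γ j)) := by
  have hlog : Summable fun j => Real.log (1 + γ j) := by
    simpa using summable_log_one_add_mul h.summable 1
  have h1 : ∑' j, γ j ≤ ∑' j, 3 / 2 * Real.log (1 + γ j) := by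
    refine h.summable.tsum_le_tsum (fun j => ?_) (hlog.mul_left _)
    have h2 := Real.le_log_one_add_of_nonneg (h.nonneg j)
    have h3 : 2 * γ j / 3 ≤ 2 * γ j / (γ j + 2) := by
      have := h.nonneg j
      have := h.le_one j
      gcongr
      linarith
    linarith
  rw [tsum_mul_left] at h1
  linarith [h.nonneg_exp]

/-- Compactness of the products `exp (α w) * ∏ (1 + γ j * w)`, in logarithmic form. -/
theorem exists_limit_shiftedData {ι : Type*} (U : Ultrafilter ι) {α : ι → ℝ} {γ : ι → ℕ → ℝ}
    (h : ∀ n, IsShiftedData (α n) (γ n)) {M : ℝ}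
    (hM : ∀ᶠ n in (U : Filter ι), α n + ∑' j, γ n j ≤ M) :
    ∃ α' γ', IsShiftedData α' γ' ∧ ∀ x : ℝ, 0 ≤ x →
      Tendsto (fun n => α n * x + ∑' j, Real.log (1 + γ n j * x)) U
        (𝓝 (α' * x + ∑' j, Real.log (1 + γ' j * x))) := by
  have hts : ∀ n, 0 ≤ ∑' j, γ n j := fun n => tsum_nonneg (h n).nonneg
  have hγ : ∀ j, ∃ c ∈ Set.Icc (0 : ℝ) 1, Tendsto (fun n => γ n j) U (𝓝 c) := fun j =>
    isCompact_Icc.ultrafilter_le_nhds' (U.map fun n => γ n j)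
      (Ultrafilter.mem_map.2 (univ_mem' fun n => ⟨(h n).nonneg j, (h n).le_one j⟩))
  obtain ⟨s, -, hs⟩ : ∃ s ∈ Set.Icc (0 : ℝ) M,
      Tendsto (fun n => α n + ∑' j, γ n j) U (𝓝 s) :=
    isCompact_Icc.ultrafilter_le_nhds' (U.map fun n => α n + ∑' j, γ n j)
      (Ultrafilter.mem_map.2 (hM.mono fun n hn => ⟨add_nonneg (h n).nonneg_exp (hts n), hn⟩))
  choose γ' hγ' hlim using hγ
  have hpart : ∀ u : Finset ℕ, ∑ j ∈ u, γ' j ≤ s := fun u =>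
    le_of_tendsto_of_tendsto' (tendsto_finsetSum u fun j _ => hlim j) hs fun n => by
      have := (h n).summable.sum_le_tsum u fun j _ => (h n).nonneg j
      linarith [(h n).nonneg_exp]
  have hsum : Summable γ' := summable_of_sum_le (fun j => (hγ' j).1) hpart
  -- The new exponent is the limit of the total mass minus what the limiting factors retain.
  have hd : IsShiftedData (s - ∑' j, γ' j) γ' :=
    { nonneg_exp := sub_nonneg.2 (hsum.tsum_le_of_sum_le hpart)
      anti := fun i j hij => le_of_tendsto_of_tendsto' (hlim j) (hlim i) fun n => (h n).anti hij
      nonneg := fun j => (hγ' j).1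
      le_one := fun j => (hγ' j).2
      summable := hsum }
  refine ⟨_, γ', hd, fun x hx => ?_⟩
  -- Removing the linear part leaves terms quadratic in δ_j; since γ_j ≤ M/(j+1) by monotonicity,
  -- they are dominated independently of n.
  have rewr : ∀ (c : ℝ) (δ : ℕ → ℝ), Summable δ → c * x + ∑' j, Real.log (1 + δ j * x) =
      (c + ∑' j, δ j) * x + ∑' j, (Real.log (1 + δ j * x) - δ j * x) := by
    intro c δ hδ
    rw [(summable_log_one_add_mul hδ x).tsum_sub (hδ.mul_right x), tsum_mul_right]
    ring
  rw [rewr _ _ hsum, sub_add_cancel]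
  simp only [fun n => rewr (α n) (γ n) (h n).summable]
  refine (hs.mul_const x).add ?_
  have hbound : Summable fun j : ℕ => (M * x) ^ 2 * (1 / ((j : ℝ) + 1) ^ 2) := by
    refine Summable.mul_left _ ?_
    exact_mod_cast (summable_nat_add_iff 1).2
      (Real.summable_one_div_nat_pow.2 one_lt_two)
  refine tendsto_tsum_of_dominated_convergence hbound (fun j => ?_) ?_
  · have hpos : 1 + γ' j * x ≠ 0 := by have := mul_nonneg (hγ' j).1 hx; positivity
    exact ((((hlim j).mul_const x).const_add 1).log hpos).sub ((hlim j).mul_const x)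
  · filter_upwards [hM] with n hn j
    have h0 := (h n).nonneg j
    have hnM : ∑' j, γ n j ≤ M := by linarith [(h n).nonneg_exp]
    have h1 := (h n).anti.le_div_of_tsum_le (h n).nonneg (h n).summable hnM j
    calc ‖Real.log (1 + γ n j * x) - γ n j * x‖ ≤ (γ n j * x) ^ 2 :=
          log_one_add_mul_sub_bounds h0 hx
      _ ≤ (M / (j + 1) * x) ^ 2 := by gcongr
      _ = _ := by field_simp

/-- The entire function `exp (α w) * ∏ (1 + γ j * w)`. -/
noncomputable def shiftedProduct (α : ℝ) (γ : ℕ → ℝ) (w : ℂ) : ℂ :=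
  Complex.exp (α * w) * ∏' j, (1 + (γ j : ℂ) * w)

theorem differentiable_shiftedProduct (α : ℝ) {γ : ℕ → ℝ} (h : Summable γ) :
    Differentiable ℂ (shiftedProduct α γ) :=
  Differentiable.mul (by fun_prop) (differentiable_tprod_one_add_mul h)

theorem IsShiftedData.shiftedProduct_ofReal {α : ℝ} {γ : ℕ → ℝ} (h : IsShiftedData α γ) {x : ℝ}
    (hx : 0 ≤ x) : shiftedProduct α γ x =
      (Real.exp (α * x + ∑' j, Real.log (1 + γ j * x)) : ℝ) := by
  have hp : ∀ j, 0 < 1 + γ j * x := fun j => by have := mul_nonneg (h.nonneg j) hx; positivity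
  have h1 := Real.hasProd_of_hasSum_log hp (summable_log_one_add_mul h.summable x).hasSum
  have h2 : HasProd (fun j => 1 + (γ j : ℂ) * x)
      (Real.exp (∑' j, Real.log (1 + γ j * x)) : ℝ) := by
    simpa [Function.comp_def] using h1.map Complex.ofRealHom Complex.continuous_ofReal
  rw [shiftedProduct, h2.tprod_eq, Real.exp_add]
  push_cast
  rfl

theorem IsShiftedData.norm_shiftedProduct_le_one {α : ℝ} {γ : ℕ → ℝ} (h : IsShiftedData α γ)
    {x : ℝ} (hx : x ∈ Set.Icc (-1 : ℝ) 0) : ‖shiftedProduct α γ x‖ ≤ 1 := by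
  have h1 : ‖∏' j, (1 + (γ j : ℂ) * x)‖ ≤ 1 := by
    refine le_of_tendsto' (hasProd_one_add_mul h.summable x).norm fun s =>
      Finset.prod_le_one (fun j _ => norm_nonneg _) fun j _ => ?_
    have e : (1 + (γ j : ℂ) * x) = ((1 + γ j * x : ℝ) : ℂ) := by push_cast; rfl
    rw [e, Complex.norm_real, Real.norm_eq_abs, abs_le]
    have h0 := h.nonneg j
    have h1 := h.le_one j
    constructor <;> nlinarith [hx.1, hx.2]
  have h2 : ‖Complex.exp (α * x)‖ ≤ 1 := by
    rw [← Complex.ofReal_mul, ← Complex.ofReal_exp, Complex.norm_real, Real.norm_eq_abs,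
      Real.abs_exp, Real.exp_le_one_iff]
    exact mul_nonpos_of_nonneg_of_nonpos h.nonneg_exp hx.2
  rw [shiftedProduct, norm_mul]
  exact mul_le_one₀ h2 (norm_nonneg _) h1

/-- Follows from 1 + β(1+w) = (1+β)(1 + δw) with δ = β/(1+β). The factor (1+w)ˡ supplies l leading
ones, which keeps the sequence antitone. -/
theorem exists_shiftedProduct_of_mem_laguerrePlus {f : ℂ → ℂ} (hf : f ∈ laguerrePlus) :
    ∃ α γ, IsShiftedData α γ ∧ ∀ w, f (1 + w) = f 1 * shiftedProduct α γ w := by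
  obtain ⟨C, l, α, β, hα, hanti, hnn, hsum, h⟩ := mem_laguerrePlus_iff.1 hf
  have hpos : ∀ j, 0 < 1 + β j := fun j => by linarith [hnn j]
  set δ : ℕ → ℝ := fun j => β j / (1 + β j) with hδ
  have hδ0 : ∀ j, 0 ≤ δ j := fun j => div_nonneg (hnn j) (hpos j).le
  have hδ1 : ∀ j, δ j ≤ 1 := fun j => (div_le_one (hpos j)).2 (by linarith)
  have hδs : Summable δ := hsum.of_nonneg_of_le hδ0 fun j =>
    div_le_self (hnn j) (by linarith [hnn j])
  have hδa : Antitone δ := fun i j hij => by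
    rw [hδ, div_le_div_iff₀ (hpos j) (hpos i)]
    nlinarith [hanti hij]
  set γ : ℕ → ℝ := fun j => if j < l then 1 else δ (j - l) with hγ
  have hγl : ∀ j, γ (j + l) = δ j := fun j => by simp [hγ]
  have hγs : Summable γ := (summable_nat_add_iff l).1 (by simpa only [hγl] using hδs)
  refine ⟨α, γ, ⟨hα, fun i j hij => ?_, fun j => ?_, fun j => ?_, hγs⟩, fun w => ?_⟩
  · simp only [hγ]
    split_ifs with h1 h2 h2
    · exact le_rfl
    · omega
    · exact hδ1 _
    · exact hδa (by omega)
  · simp only [hγ]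
    split_ifs
    exacts [zero_le_one, hδ0 _]
  · simp only [hγ]
    split_ifs
    exacts [le_rfl, hδ1 _]
  · have hP : ∏' j, (1 + (β j : ℂ) * (1 + w))
        = (∏' j, (1 + (β j : ℂ) * 1)) * ∏' j, (1 + (δ j : ℂ) * w) := by
      refine HasProd.tprod_eq ?_
      convert (hasProd_one_add_mul hsum 1).mul (hasProd_one_add_mul hδs w) using 2 with j
      have : (1 + β j : ℂ) ≠ 0 := by exact_mod_cast (hpos j).ne'
      simp only [hδ]
      push_cast
      field_simp
      ring
    have hQ : ∏' j, (1 + (γ j : ℂ) * w) = (1 + w) ^ l * ∏' j, (1 + (δ j : ℂ) * w) := by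
      have h1 : HasProd (fun j => 1 + (γ (j + l) : ℂ) * w) (∏' j, (1 + (δ j : ℂ) * w)) := by
        simpa only [hγl] using hasProd_one_add_mul hδs w
      have h2 : ∏ j ∈ Finset.range l, (1 + (γ j : ℂ) * w) = (1 + w) ^ l := by
        rw [← Finset.card_range l, ← Finset.prod_const, Finset.card_range]
        refine Finset.prod_congr rfl fun j hj => ?_
        simp [hγ, Finset.mem_range.1 hj]
      rw [(HasProd.prod_range_mul (f := fun j => 1 + (γ j : ℂ) * w) h1).tprod_eq, h2]
    rw [h, h, shiftedProduct, hP, hQ, mul_add, Complex.exp_add]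
    simp only [mul_one, one_pow]
    ring

theorem mem_laguerrePlus_of_shiftedProduct {f : ℂ → ℂ} {α : ℝ} {γ : ℕ → ℝ} {c : ℂ}
    (hd : IsShiftedData α γ) (h : ∀ w, f (1 + w) = c * shiftedProduct α γ w) :
    f ∈ laguerrePlus := by
  classical
  have hex : ∃ n, γ n < 1 :=
    (hd.summable.tendsto_atTop_zero.eventually_lt_const zero_lt_one).exists
  -- The terms before l equal 1 and give zˡ; from l on, 1 - γ_j is at least 1 - γ_l > 0, so
  -- γ_j/(1-γ_j) stays summable.
  set l := Nat.find hex with hl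
  have hl1 : ∀ j, j < l → γ j = 1 := fun j hj =>
    (hd.le_one j).antisymm (not_lt.1 (Nat.find_min hex hj))
  have hpos0 : 0 < 1 - γ l := sub_pos.2 (Nat.find_spec hex)
  have hle : ∀ j, 1 - γ l ≤ 1 - γ (j + l) := fun j =>
    sub_le_sub_left (hd.anti (Nat.le_add_left l j)) 1
  have hpos : ∀ j, 0 < 1 - γ (j + l) := fun j => hpos0.trans_le (hle j)
  have hγs : Summable fun j => γ (j + l) := (summable_nat_add_iff l).2 hd.summable
  set β : ℕ → ℝ := fun j => γ (j + l) / (1 - γ (j + l)) with hβ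
  have hβ0 : ∀ j, 0 ≤ β j := fun j => div_nonneg (hd.nonneg _) (hpos j).le
  have hβs : Summable β := (hγs.div_const (1 - γ l)).of_nonneg_of_le hβ0 fun j =>
    div_le_div_of_nonneg_left (hd.nonneg _) hpos0 (hle j)
  refine mem_laguerrePlus_iff.2 ⟨c * Complex.exp (-α) * ∏' j, (1 + (γ (j + l) : ℂ) * (-1)), l, α, β,
    hd.nonneg_exp, fun i j hij => ?_, hβ0, hβs, fun z => ?_⟩
  · have h1 : γ (j + l) ≤ γ (i + l) := hd.anti (by omega)
    exact div_le_div₀ (hd.nonneg _) h1 (hpos i) (by linarith)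
  · have hP : HasProd (fun j => 1 + (γ (j + l) : ℂ) * (z - 1))
        ((∏' j, (1 + (γ (j + l) : ℂ) * (-1))) * ∏' j, (1 + (β j : ℂ) * z)) := by
      convert (hasProd_one_add_mul hγs (-1)).mul (hasProd_one_add_mul hβs z) using 2 with j
      have : (1 - γ (j + l) : ℂ) ≠ 0 := by exact_mod_cast (hpos j).ne'
      simp only [hβ]
      push_cast
      field_simp
      ring
    have e : f z = c * shiftedProduct α γ (z - 1) := by rw [← h, add_sub_cancel]
    rw [e, shiftedProduct,
      (HasProd.prod_range_mul (f := fun j => 1 + (γ j : ℂ) * (z - 1)) hP).tprod_eq,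
      Finset.prod_congr rfl fun j hj => by
        rw [hl1 j (Finset.mem_range.1 hj), Complex.ofReal_one, one_mul, add_sub_cancel],
      Finset.prod_const, Finset.card_range, mul_sub, mul_one, sub_eq_add_neg, Complex.exp_add]
    ring

/-! ### Closure under nonzero limits -/

theorem eq_of_eq_ofReal_nonneg {f g : ℂ → ℂ} (hf : Differentiable ℂ f) (hg : Differentiable ℂ g)
    (u : ℝ) {v : ℝ} (huv : u < v) (h : ∀ x : ℝ, u ≤ x → x ≤ v → f x = g x) : f = g := by
  have hc : ContinuousAt (fun x : ℝ => (x : ℂ)) u := Complex.continuous_ofReal.continuousAt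
  refine AnalyticOnNhd.eq_of_frequently_eq (z₀ := (u : ℂ)) (fun z _ => hf.analyticAt z)
    (fun z _ => hg.analyticAt z) ?_
  have ht : Tendsto (fun x : ℝ => (x : ℂ)) (𝓝[>] u) (𝓝[≠] (u : ℂ)) := by
    refine tendsto_nhdsWithin_iff.2 ⟨hc.tendsto.mono_left nhdsWithin_le_nhds, ?_⟩
    filter_upwards [self_mem_nhdsWithin] with x hx
    simpa using (ne_of_gt hx)
  refine ht.frequently (Eventually.frequently ?_)
  filter_upwards [Ioo_mem_nhdsGT huv] with x hx
  exact h x hx.1.le hx.2.le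

/-- On [0,1] each |f_n| is at most |f_n(1)|, so g(1) = 0 would make g vanish on [0,1], hence
everywhere. -/
theorem apply_one_ne_zero_of_tendsto {f : ℕ → ℂ → ℂ} {g : ℂ → ℂ} (hf : ∀ n, f n ∈ laguerrePlus)
    (hgd : Differentiable ℂ g) (hg : ∃ z, g z ≠ 0)
    (hlim : ∀ z, Tendsto (fun n => f n z) atTop (𝓝 (g z))) : g 1 ≠ 0 := by
  intro h1
  have hle : ∀ x : ℝ, 0 ≤ x → x ≤ 1 → g x = 0 := by
    intro x h0 hx
    have hn : ∀ n, ‖f n x‖ ≤ ‖f n 1‖ := by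
      intro n
      obtain ⟨α, γ, hd, h⟩ := exists_shiftedProduct_of_mem_laguerrePlus (hf n)
      have e := h ((x - 1 : ℝ) : ℂ)
      rw [Complex.ofReal_sub, Complex.ofReal_one, add_sub_cancel] at e
      rw [e, norm_mul]
      refine mul_le_of_le_one_right (norm_nonneg _) ?_
      simpa using hd.norm_shiftedProduct_le_one (x := x - 1) ⟨by linarith, by linarith⟩
    have := le_of_tendsto_of_tendsto' (hlim x).norm (hlim 1).norm hn
    rwa [h1, norm_zero, norm_le_zero_iff] at this
  obtain ⟨z, hz⟩ := hg
  exact hz (congrFun (eq_of_eq_ofReal_nonneg hgd (differentiable_const 0) 0 one_pos hle) z)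

/-- Laguerre's closure theorem: nonzero limits of functions in `laguerrePlus` are in
`laguerrePlus`. -/
theorem mem_laguerrePlus_of_tendsto {f : ℕ → ℂ → ℂ} {g : ℂ → ℂ} (hf : ∀ n, f n ∈ laguerrePlus)
    (hgd : Differentiable ℂ g) (hg : ∃ z, g z ≠ 0)
    (hlim : ∀ z, Tendsto (fun n => f n z) atTop (𝓝 (g z))) : g ∈ laguerrePlus := by
  have hg1 := apply_one_ne_zero_of_tendsto hf hgd hg hlim
  choose α γ hd hfac using fun n => exists_shiftedProduct_of_mem_laguerrePlus (hf n)
  have hf1 : ∀ᶠ n in atTop, f n 1 ≠ 0 := (hlim 1).eventually_ne hg1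
  set Λ : ℕ → ℝ → ℝ := fun n x => α n * x + ∑' j, Real.log (1 + γ n j * x) with hΛ
  have hexp : ∀ x : ℝ, 0 ≤ x →
      Tendsto (fun n => ((Real.exp (Λ n x) : ℝ) : ℂ)) atTop (𝓝 (g (1 + x) / g 1)) := by
    intro x hx
    refine ((hlim (1 + x)).div (hlim 1) hg1).congr' ?_
    filter_upwards [hf1] with n hn
    rw [Pi.div_apply, hfac, mul_div_cancel_left₀ _ hn, (hd n).shiftedProduct_ofReal hx]
  -- The limit g is already given, so one cluster point of the parameters suffices; an ultrafilter
  -- replaces diagonal subsequences.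
  let U : Ultrafilter ℕ := Ultrafilter.of atTop
  have hU : (U : Filter ℕ) ≤ atTop := Ultrafilter.of_le _
  obtain ⟨M, hM⟩ : ∃ M, ∀ᶠ n in atTop, α n + ∑' j, γ n j ≤ M := by
    -- The added 1 gives an eventual strict bound on |f_n(2)/f_n(1)|; the factor 3/2 is that of
    -- `IsShiftedData.tsum_le_log`.
    set B := ‖g (1 + (1 : ℝ)) / g 1‖ + 1
    refine ⟨3 / 2 * Real.log B, ?_⟩
    filter_upwards [(hexp 1 zero_le_one).norm.eventually_lt_const (lt_add_one _)] with n hn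
    refine (hd n).tsum_le_log.trans ?_
    rw [Complex.norm_real, Real.norm_eq_abs, Real.abs_exp] at hn
    have := Real.log_le_log (Real.exp_pos _) hn.le
    rw [Real.log_exp, hΛ] at this
    simp only [mul_one] at this
    gcongr
  obtain ⟨α', γ', hd', hlim'⟩ := exists_limit_shiftedData U hd (hU hM)
  have hprod : Differentiable ℂ (shiftedProduct α' γ') := differentiable_shiftedProduct α' hd'.summable
  have key : (fun w => g (1 + w)) = fun w => g 1 * shiftedProduct α' γ' w := by
    refine eq_of_eq_ofReal_nonneg (hgd.comp (differentiable_id.const_add 1))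
      (hprod.const_mul _) 0 one_pos fun x hx _ => ?_
    have h1 := (hexp x hx).mono_left hU
    have h2 := (Complex.continuous_ofReal.tendsto _).comp
      ((Real.continuous_exp.tendsto _).comp (hlim' x hx))
    rw [hd'.shiftedProduct_ofReal hx, ← tendsto_nhds_unique h1 h2, mul_div_cancel₀ _ hg1]
  exact mem_laguerrePlus_of_shiftedProduct hd' (congrFun key)

theorem theorem2 (a : ℝ) (ha : 0 ≤ a) (f : ℕ → ExpTypeSpace a)
    (hf : ∀ n, f n ∈ laguerrePlusIn a) (g : ExpTypeSpace a) (hg : ∃ z : ℂ, g z ≠ 0)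
    (hlim : ∀ K : Set ℂ, IsCompact K →
      TendstoUniformlyOn (fun n => (f n).toFun) g.toFun atTop K) :
    ExpTypeSpace.IsBoundedSet (Set.range f) ∧
      Tendsto f atTop (𝓝 g) ∧
      g ∈ laguerrePlusIn a := by
  have hdiff : ∀ h : ExpTypeSpace a, Differentiable ℂ h.toFun := fun h =>
    (ExpTypeSpace.mem_taylorBanach (lt_add_one a) h).1
  have hloc : TendstoLocallyUniformlyOn (fun n => (f n).toFun) g.toFun atTop Set.univ :=
    (tendstoLocallyUniformlyOn_iff_forall_isCompact isOpen_univ).2 fun K _ hK => hlim K hK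
  obtain ⟨hb, ht⟩ := bounded_and_tendsto_of_tendsto_iteratedDeriv ha hf hg fun k =>
    hloc.tendsto_iteratedDeriv (fun n => hdiff (f n)) k 0
  exact ⟨hb, ht, mem_laguerrePlus_of_tendsto hf (hdiff g) hg fun z =>
    hloc.tendsto_at (Set.mem_univ z)⟩
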